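/- Let $A\in\mathbb{R}^{n\times n}$, $E\in\mathbb{R}^{n\times 1}$, $C\in\mathbb{R}^{1\times n}$ with $(A,C)$ observable and $(A,E)$ controllable, and consider the plant $\dot x = Ax + Ed$, $y = Cx$ (a known control input plays no role here). Let $\tau>0$ and let $P_N$ be the $N$-th order Padé approximation of the delay $e^{-\tau s}$, that is, $P_N=p/q$ with real polynomials $p,q$ of degree at most $N$, $q(0)=1$ and $p(s)-q(s)e^{-\tau s}=O(s^{2N+1})$ as $s\to 0$. Let $(A_N,B_N,C_N,D_N)$, with $A_N\in\mathbb{R}^{N\times N}$, be a minimal (controllable and observable) realization of it, $P_N(s)=C_N(sI_N-A_N)^{-1}B_N+D_N$. Put $$A_{aug}=\begin{bmatrix}A&0\\ B_NC&A_N\end{bmatrix},\qquad E_{aug}=\begin{bmatrix}E\\0\end{bmatrix},\qquad C_{aug}=\begin{bmatrix}D_NC&C_N\end{bmatrix},$$ and assume that $(A_{aug},C_{aug})$ is observable and $(A_{aug},E_{aug})$ is controllable. Let $V\ge 0$ and $W>0$ be the (scalar) covariances of the process noise $d$ and of the measurement noise. Let $\Sigma_{aug}$ and $\Sigma$ be the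 positive definite solutions of the algebraic Riccati equations $$0=A_{aug}\Sigma_{aug}+\Sigma_{aug}A_{aug}^T+E_{aug}VE_{aug}^T-\Sigma_{aug}C_{aug}^TW^{-1}C_{aug}\Sigma_{aug},$$ $$0=A\Sigma+\Sigma A^T+EVE^T-\Sigma C^TW^{-1}C\Sigma ,$$ and let $L_{aug}=\Sigma_{aug}C_{aug}^TW^{-1}$ and $L=\Sigma C^TW^{-1}$ be the corresponding steady-state Kalman gains, for the augmented system and for the plant without delay. Assume that the sets of (complex) eigenvalues of $A_N$, $A$ and $A-LC$ are pairwise disjoint. Then, of the $n+N$ eigenvalues of $A_{aug}-L_{aug}C_{aug}$, counted with algebraic multiplicity, (i) $N$ are identical to the eigenvalues of $A_N$, and (ii) the other $n$ are identical to the eigenvalues of $A-LC$. -/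

import Mathlib

noncomputable section

namespace DelayEstimator

/-- The eigenvalues in `ℂ` of a real square matrix, listed with algebraic multiplicity. -/
def eigenvalues {ι : Type*} [Fintype ι] [DecidableEq ι] (A : Matrix ι ι ℝ) : Multiset ℂ :=
  (A.map (algebraMap ℝ ℂ)).charpoly.roots

/-- The controllability matrix `[B, AB, …, A^(d-1) B]`, where `d` is the state dimension. -/
def controllabilityMatrix {ι κ : Type*} [Fintype ι] [DecidableEq ι]
    (A : Matrix ι ι ℝ) (B : Matrix ι κ ℝ) : Matrix ι (Fin (Fintype.card ι) × κ) ℝ :=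
  Matrix.of fun i kj => (A ^ (kj.1 : ℕ) * B) i kj.2

/-- The pair `(A, B)` is controllable. -/
def Controllable {ι κ : Type*} [Fintype ι] [DecidableEq ι] [Fintype κ]
    (A : Matrix ι ι ℝ) (B : Matrix ι κ ℝ) : Prop :=
  (controllabilityMatrix A B).rank = Fintype.card ι

/-- The observability matrix with block rows `C, CA, …, C A^(d-1)`, where `d` is the state
dimension. -/
def observabilityMatrix {ι κ : Type*} [Fintype ι] [DecidableEq ι]
    (A : Matrix ι ι ℝ) (C : Matrix κ ι ℝ) : Matrix (Fin (Fintype.card ι) × κ) ι ℝ :=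
  Matrix.of fun kj i => (C * A ^ (kj.1 : ℕ)) kj.2 i

/-- The pair `(A, C)` is observable. -/
def Observable {ι κ : Type*} [Fintype ι] [DecidableEq ι]
    (A : Matrix ι ι ℝ) (C : Matrix κ ι ℝ) : Prop :=
  (observabilityMatrix A C).rank = Fintype.card ι

/-- The transfer function `C (sI - A)⁻¹ B + D` of a single-input single-output system, as a
rational function of `s`. The matrix `sI - A` is invertible over the field of rational functions. -/
def transferFunction {ι : Type*} [Fintype ι] [DecidableEq ι] (A : Matrix ι ι ℝ)
    (B : Matrix ι (Fin 1) ℝ) (C : Matrix (Fin 1) ι ℝ) (D : ℝ) : RatFunc ℝ :=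
  (C.map RatFunc.C * (Matrix.scalar ι RatFunc.X - A.map RatFunc.C)⁻¹ * B.map RatFunc.C :
    Matrix (Fin 1) (Fin 1) (RatFunc ℝ)) 0 0
    + RatFunc.C D

/-- `P` is the `N`-th order (that is, `[N/N]`) Padé approximant of `s ↦ exp (-τ s)`: a quotient
`p / q` of polynomials of degree at most `N`, with `q 0 = 1`, such that
`p(s) - q(s) exp (-τ s)` vanishes to order `2 N + 1` at `s = 0`. -/
def IsPadeOfDelay (τ : ℝ) (N : ℕ) (P : RatFunc ℝ) : Prop :=
  ∃ p q : Polynomial ℝ, p.natDegree ≤ N ∧ q.natDegree ≤ N ∧ q.coeff 0 = 1 ∧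
    P = algebraMap (Polynomial ℝ) (RatFunc ℝ) p / algebraMap (Polynomial ℝ) (RatFunc ℝ) q ∧
    (PowerSeries.X : PowerSeries ℝ) ^ (2 * N + 1) ∣
      (p : PowerSeries ℝ)
        - (q : PowerSeries ℝ) * PowerSeries.rescale (-τ) (PowerSeries.exp ℝ)

/-- `(AN, BN, CN, DN)`, with `N` states, is a minimal realization of the `N`-th order Padé
approximant of the delay `exp (-τ s)`. -/
structure IsMinimalPadeRealization (τ : ℝ) {N : ℕ} (AN : Matrix (Fin N) (Fin N) ℝ)
    (BN : Matrix (Fin N) (Fin 1) ℝ) (CN : Matrix (Fin 1) (Fin N) ℝ) (DN : ℝ) : Prop where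
  isPade : IsPadeOfDelay τ N (transferFunction AN BN CN DN)
  controllable : Controllable AN BN
  observable : Observable AN CN

/-- State matrix of the plant augmented with the delay model. -/
def augA {n N : ℕ} (A : Matrix (Fin n) (Fin n) ℝ) (C : Matrix (Fin 1) (Fin n) ℝ)
    (AN : Matrix (Fin N) (Fin N) ℝ) (BN : Matrix (Fin N) (Fin 1) ℝ) :
    Matrix (Fin n ⊕ Fin N) (Fin n ⊕ Fin N) ℝ :=
  Matrix.fromBlocks A 0 (BN * C) AN

/-- Disturbance input matrix of the augmented system: the disturbance enters only the plant. -/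
def augE {n : ℕ} (N : ℕ) (E : Matrix (Fin n) (Fin 1) ℝ) : Matrix (Fin n ⊕ Fin N) (Fin 1) ℝ :=
  Matrix.fromRows E 0

/-- Output matrix of the augmented system. -/
def augC {n N : ℕ} (C : Matrix (Fin 1) (Fin n) ℝ) (CN : Matrix (Fin 1) (Fin N) ℝ) (DN : ℝ) :
    Matrix (Fin 1) (Fin n ⊕ Fin N) ℝ :=
  Matrix.fromCols (DN • C) CN

/-- `S` is a positive definite (in particular symmetric) solution of the filter algebraic Riccati
equation `0 = A S + S Aᵀ + E V Eᵀ - S Cᵀ W⁻¹ C S`. -/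
structure IsPosDefRiccatiSolution {ι : Type*} [Fintype ι] (A : Matrix ι ι ℝ)
    (E : Matrix ι (Fin 1) ℝ) (C : Matrix (Fin 1) ι ℝ) (V W : ℝ) (S : Matrix ι ι ℝ) : Prop where
  posDef : S.PosDef
  riccati : 0 = A * S + S * A.transpose + V • (E * E.transpose)
    - W⁻¹ • (S * C.transpose * C * S)

/-- The steady-state Kalman gain `S Cᵀ W⁻¹`. -/
def kalmanGain {ι : Type*} [Fintype ι] (S : Matrix ι ι ℝ) (C : Matrix (Fin 1) ι ℝ) (W : ℝ) :
    Matrix ι (Fin 1) ℝ :=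
  W⁻¹ • (S * C.transpose)

end DelayEstimator

end

open DelayEstimator

/-! The proof is a spectral factorization. With G = C(sI - A)⁻¹E, the Riccati equation gives
χ_cl(s)χ_cl(-s) = χ(s)χ(-s)(1 + (V/W) G(s)G(-s)), where χ and χ_cl are the characteristic
polynomials of A and A - LC (`IsPosDefRiccatiSolution.aeval_charpoly_mul`). The augmented system has
gain P_N G (`complexGain_aug`) and open-loop polynomial χ χ_N, with χ_N that of A_N.

The Padé approximant is all-pass: P_N(s) = χ_N(-s)/χ_N(s) (`IsPadeOfDelay.aeval_transferNumerator`).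
So P_N(s)P_N(-s) = 1, the bracket is the same for both filters, and the augmented closed-loop
polynomial has the same product with its reflection as χ_N χ_cl.

Stability then separates each polynomial from its reflection (`eq_of_mul_comp_neg_X_eq`). χ_N is
Hurwitz because it is a rescaled reverse Bessel polynomial. A Lyapunov argument puts the closed-loop
roots in Re ≤ 0, and disjointness of the spectra of A and A - LC keeps those of χ_cl off the
imaginary axis. -/

open DelayEstimator

/-! ### Reverse Bessel polynomials and Padé approximants of the exponential. -/

namespace DelayEstimator

open Polynomial

/-- The reverse Bessel polynomials. -/
noncomputable def reverseBessel : ℕ → ℝ[X]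
  | 0 => 1
  | 1 => X + 1
  | n + 2 => C (2 * (n : ℝ) + 3) * reverseBessel (n + 1) + X ^ 2 * reverseBessel n

theorem reverseBessel_succ_succ (n : ℕ) : reverseBessel (n + 2) =
    C (2 * (n : ℝ) + 3) * reverseBessel (n + 1) + X ^ 2 * reverseBessel n := by
  rw [reverseBessel]

theorem reverseBessel_eval_zero_pos (n : ℕ) : 0 < (reverseBessel n).eval 0 := by
  induction n using reverseBessel.induct with
  | case1 => simp [reverseBessel]
  | case2 => simp [reverseBessel]
  | case3 n h1 h0 =>
    rw [reverseBessel_succ_succ]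
    simp only [eval_add, eval_mul, eval_C, eval_pow, eval_X]
    have : 0 < (2 * (n : ℝ) + 3) * (reverseBessel (n + 1)).eval 0 := by positivity
    simpa using this

theorem reverseBessel_natDegree_le (n : ℕ) : (reverseBessel n).natDegree ≤ n := by
  induction n using reverseBessel.induct with
  | case1 => simp [reverseBessel]
  | case2 => rw [reverseBessel]; compute_degree
  | case3 n h1 h0 =>
    rw [reverseBessel_succ_succ]
    refine natDegree_add_le_of_degree_le ((natDegree_C_mul_le _ _).trans (by lia)) ?_
    refine natDegree_mul_le.trans ?_
    rw [natDegree_X_pow]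
    lia

theorem reverseBessel_coeff_self (n : ℕ) : (reverseBessel n).coeff n = 1 := by
  induction n using reverseBessel.induct with
  | case1 => simp [reverseBessel]
  | case2 => simp [reverseBessel, coeff_one]
  | case3 n h1 h0 =>
    rw [reverseBessel_succ_succ, coeff_add, coeff_C_mul,
      coeff_eq_zero_of_natDegree_lt ((reverseBessel_natDegree_le (n + 1)).trans_lt (by lia)),
      coeff_X_pow_mul, h0]
    simp

theorem reverseBessel_natDegree (n : ℕ) : (reverseBessel n).natDegree = n :=
  natDegree_eq_of_le_of_coeff_ne_zero (reverseBessel_natDegree_le n)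
    (by simp [reverseBessel_coeff_self])

/-- Dividing the recurrence by z θ_{n+1} gives the continued fraction u_{n+1} = (2n+3)/z + 1/u_n for
these ratios, and inversion preserves the right half-plane. -/
theorem re_reverseBessel_ratio_pos (n : ℕ) {z : ℂ} (hz : 0 ≤ z.re) (hz0 : z ≠ 0) :
    0 < (aeval z (reverseBessel (n + 1)) / (z * aeval z (reverseBessel n))).re := by
  induction n with
  | zero =>
    have h : aeval z (reverseBessel 1) / (z * aeval z (reverseBessel 0)) = 1 + z⁻¹ := by
      simp [reverseBessel]
      field_simp
    rw [h, Complex.add_re, Complex.inv_re, Complex.one_re]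
    have := div_nonneg hz (Complex.normSq_nonneg z)
    linarith
  | succ n ih =>
    set u := aeval z (reverseBessel (n + 1)) / (z * aeval z (reverseBessel n)) with hu
    have hu0 : u ≠ 0 := by
      intro h
      simp [h] at ih
    have h1 : aeval z (reverseBessel (n + 1)) ≠ 0 := by
      intro h
      simp [hu, h] at hu0
    have h0 : aeval z (reverseBessel n) ≠ 0 := by
      intro h
      simp [hu, h] at hu0
    have h : aeval z (reverseBessel (n + 1 + 1)) / (z * aeval z (reverseBessel (n + 1)))
        = ((2 * (n : ℝ) + 3 : ℝ) : ℂ) * z⁻¹ + u⁻¹ := by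
      rw [reverseBessel_succ_succ, hu]
      simp only [map_add, map_mul, aeval_C, aeval_X, map_pow, Complex.coe_algebraMap]
      push_cast
      field_simp
    rw [h, Complex.add_re, Complex.re_ofReal_mul, Complex.inv_re, Complex.inv_re]
    have h2 := div_nonneg hz (Complex.normSq_nonneg z)
    have h3 := div_pos ih (Complex.normSq_pos.2 hu0)
    have h4 : (0 : ℝ) ≤ 2 * (n : ℝ) + 3 := by positivity
    have := mul_nonneg h4 h2
    linarith

/-- The reverse Bessel polynomials are Hurwitz. -/
theorem aeval_reverseBessel_ne_zero (n : ℕ) {z : ℂ} (hz : 0 ≤ z.re) :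
    aeval z (reverseBessel n) ≠ 0 := by
  rcases eq_or_ne z 0 with rfl | hz0
  · have h := (reverseBessel_eval_zero_pos n).ne'
    rw [← coe_aeval_eq_eval] at h
    have h2 := aeval_algebraMap_apply ℂ (0 : ℝ) (reverseBessel n)
    rw [map_zero] at h2
    rw [h2]
    simpa using h
  · intro h
    have := re_reverseBessel_ratio_pos n hz hz0
    simp [h] at this

theorem coe_comp_C_mul_X (p : ℝ[X]) (a : ℝ) :
    ((p.comp (C a * X) : ℝ[X]) : PowerSeries ℝ) = PowerSeries.rescale a (p : PowerSeries ℝ) := by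
  ext k
  rw [coeff_coe, comp_C_mul_X_coeff, PowerSeries.coeff_rescale, coeff_coe, mul_comm]

/-- `θ(-s) exp s - θ(s) exp (-s)` for the reverse Bessel polynomial `θ`. -/
noncomputable def besselRemainder (n : ℕ) : PowerSeries ℝ :=
  PowerSeries.rescale (-1) (reverseBessel n : PowerSeries ℝ) * PowerSeries.exp ℝ
    - (reverseBessel n : PowerSeries ℝ) * PowerSeries.rescale (-1) (PowerSeries.exp ℝ)

theorem besselRemainder_succ_succ (n : ℕ) : besselRemainder (n + 2) =
    (2 * (n : PowerSeries ℝ) + 3) * besselRemainder (n + 1)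
      + PowerSeries.X ^ 2 * besselRemainder n := by
  have h : ((reverseBessel (n + 2) : ℝ[X]) : PowerSeries ℝ)
      = (2 * (n : PowerSeries ℝ) + 3) * (reverseBessel (n + 1) : PowerSeries ℝ)
        + PowerSeries.X ^ 2 * (reverseBessel n : PowerSeries ℝ) := by
    rw [reverseBessel_succ_succ]
    push_cast
    rw [show (2 * (n : ℝ) + 3) = ((2 * n + 3 : ℕ) : ℝ) by push_cast; rfl, map_natCast]
    push_cast
    rfl
  simp only [besselRemainder, h, map_add, map_mul, map_pow, PowerSeries.rescale_X, map_natCast,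
    map_ofNat, map_neg, map_one]
  ring

open PowerSeries in
theorem derivative_rescale_neg_one_exp :
    d⁄dX ℝ (rescale (-1) (exp ℝ)) = - rescale (-1) (exp ℝ) := by
  ext k
  simp only [PowerSeries.coeff_derivative, coeff_rescale, coeff_exp, map_neg, pow_succ,
    Nat.factorial_succ]
  have : (k.factorial : ℝ) ≠ 0 := by positivity
  have : (k : ℝ) + 1 ≠ 0 := by positivity
  simp
  field_simp

-- The remainder inherits the Bessel recurrence, since X² is even. Differentiating it and applying
-- the two previous cases leaves (2n+5) - 2 = 2n+3, which is the recurrence one index lower.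
open PowerSeries in
theorem derivative_besselRemainder (n : ℕ) :
    d⁄dX ℝ (besselRemainder (n + 1)) = - PowerSeries.X * besselRemainder n := by
  have h1 : besselRemainder 1 = (1 - PowerSeries.X) * exp ℝ
      - (1 + PowerSeries.X) * rescale (-1) (exp ℝ) := by
    simp [besselRemainder, reverseBessel, PowerSeries.rescale_X]
    ring
  have h0 : besselRemainder 0 = exp ℝ - rescale (-1) (exp ℝ) := by
    simp [besselRemainder, reverseBessel]
  have hd0 : d⁄dX ℝ (besselRemainder 1) = - PowerSeries.X * besselRemainder 0 := by
    rw [h1, h0]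
    simp only [map_sub, map_add, Derivation.leibniz, derivative_rescale_neg_one_exp,
      derivative_exp, PowerSeries.derivative_X, smul_eq_mul, Derivation.map_one_eq_zero]
    ring
  have hd (k : ℕ) : d⁄dX ℝ (2 * (k : PowerSeries ℝ) + 3) = 0 := by
    have : (2 * (k : PowerSeries ℝ) + 3) = ((2 * k + 3 : ℕ) : PowerSeries ℝ) := by push_cast; rfl
    rw [this, Derivation.map_natCast]
  induction n using Nat.twoStepInduction with
  | zero => exact hd0
  | one =>
    have h := besselRemainder_succ_succ 0
    rw [h]
    simp only [map_add, Derivation.leibniz, hd, hd0, smul_eq_mul, PowerSeries.derivative_pow, PowerSeries.derivative_X]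
    have : d⁄dX ℝ (besselRemainder 0) = exp ℝ + rescale (-1) (exp ℝ) := by
      rw [h0, map_sub, derivative_rescale_neg_one_exp, derivative_exp]; ring
    rw [this, h1, h0]
    push_cast
    ring
  | more n ih0 ih1 =>
    rw [besselRemainder_succ_succ (n + 1)]
    simp only [map_add, Derivation.leibniz, hd, ih0, ih1, smul_eq_mul, PowerSeries.derivative_pow,
      PowerSeries.derivative_X]
    rw [besselRemainder_succ_succ n]
    push_cast
    ring

-- Each step gains two orders: one from the factor X in the derivative formula, one from integrating
-- with zero constant term.
open PowerSeries in
theorem X_pow_dvd_besselRemainder (n : ℕ) :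
    (PowerSeries.X : PowerSeries ℝ) ^ (2 * n + 1) ∣ besselRemainder n := by
  have hc (n : ℕ) : PowerSeries.coeff 0 (besselRemainder n) = 0 := by
    have h (f : PowerSeries ℝ) :
        constantCoeff (rescale (-1) f) = constantCoeff f := by
      rw [← coeff_zero_eq_constantCoeff_apply, coeff_rescale]
      simp
    simp [besselRemainder, h]
  induction n with
  | zero => simpa [PowerSeries.X_dvd_iff] using hc 0
  | succ n ih =>
    rw [PowerSeries.X_pow_dvd_iff]
    intro m hm
    cases m with
    | zero => exact hc _
    | succ m =>
      have h := congrArg (PowerSeries.coeff m) (derivative_besselRemainder n)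
      have h2 : (PowerSeries.X : PowerSeries ℝ) ^ (2 * n + 2) ∣
          - PowerSeries.X * besselRemainder n := by
        rw [neg_mul, dvd_neg, show 2 * n + 2 = (2 * n + 1) + 1 from rfl, pow_succ']
        exact mul_dvd_mul_left _ ih
      rw [PowerSeries.coeff_derivative, PowerSeries.X_pow_dvd_iff.1 h2 m (by lia)] at h
      exact (mul_eq_zero.1 h).resolve_right (by positivity)

/-- Substitute s ↦ τs/2 in the Bessel remainder and multiply by exp(-τs/2). -/
theorem pade_denominator_dvd (τ : ℝ) (N : ℕ) :
    (PowerSeries.X : PowerSeries ℝ) ^ (2 * N + 1) ∣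
      (((reverseBessel N).comp (C (-(τ / 2)) * X) : ℝ[X]) : PowerSeries ℝ)
      - (((reverseBessel N).comp (C (τ / 2) * X) : ℝ[X]) : PowerSeries ℝ)
        * PowerSeries.rescale (-τ) (PowerSeries.exp ℝ) := by
  obtain ⟨g, hg⟩ := X_pow_dvd_besselRemainder N
  have h := congrArg (fun f => PowerSeries.rescale (τ / 2) f
    * PowerSeries.rescale (-(τ / 2)) (PowerSeries.exp ℝ)) hg
  simp only [besselRemainder, map_sub, map_mul, map_pow, PowerSeries.rescale_rescale,
    PowerSeries.rescale_X, ← coe_comp_C_mul_X, sub_mul, mul_assoc,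
    PowerSeries.exp_mul_exp_eq_exp_add] at h
  refine ⟨PowerSeries.C (τ / 2) ^ (2 * N + 1) * (PowerSeries.rescale (τ / 2) g *
    PowerSeries.rescale (-(τ / 2)) (PowerSeries.exp ℝ)), ?_⟩
  rw [mul_pow] at h
  convert h using 1
  · have h1 : τ / 2 + -(τ / 2) = 0 := by ring
    have h2 : -(τ / 2) + -(τ / 2) = -τ := by ring
    have h3 : -1 * (τ / 2) = -(τ / 2) := by ring
    simp only [coe_comp_C_mul_X, PowerSeries.rescale_rescale, h1, h2, h3]
    simp
  · ring

/-- Padé approximants of the delay are unique as rational functions. -/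
theorem pade_cross_mul_eq {f : PowerSeries ℝ} {N : ℕ} {p q p' q' : ℝ[X]} (hp : p.natDegree ≤ N)
    (hq : q.natDegree ≤ N) (hp' : p'.natDegree ≤ N) (hq' : q'.natDegree ≤ N)
    (h : (PowerSeries.X : PowerSeries ℝ) ^ (2 * N + 1) ∣ (p : PowerSeries ℝ) - q * f)
    (h' : (PowerSeries.X : PowerSeries ℝ) ^ (2 * N + 1) ∣ (p' : PowerSeries ℝ) - q' * f) :
    p * q' = p' * q := by
  have h1 : (PowerSeries.X : PowerSeries ℝ) ^ (2 * N + 1) ∣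
      ((p * q' - p' * q : ℝ[X]) : PowerSeries ℝ) := by
    have := dvd_sub (h.mul_right (q' : PowerSeries ℝ)) (h'.mul_right (q : PowerSeries ℝ))
    convert this using 1
    push_cast
    ring
  rw [← sub_eq_zero]
  ext k
  rw [coeff_zero]
  rcases lt_or_ge k (2 * N + 1) with hk | hk
  · simpa only [coeff_coe] using PowerSeries.X_pow_dvd_iff.1 h1 k hk
  -- Both cross products have degree at most 2N, one below the order of vanishing.
  · refine coeff_eq_zero_of_natDegree_lt (lt_of_le_of_lt ?_ (Nat.lt_of_succ_le hk))
    exact (natDegree_sub_le_of_le (natDegree_mul_le_of_le hp hq')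
      (natDegree_mul_le_of_le hp' hq)).trans (by simp; lia)

end DelayEstimator

/-! ### The delay model as an all-pass transfer function. -/

namespace DelayEstimator

open Polynomial

section TransferNumerator

variable {ι : Type*} [Fintype ι] [DecidableEq ι]

/-- The numerator of the transfer function over the characteristic polynomial. -/
noncomputable def transferNumerator (A : Matrix ι ι ℝ) (B : Matrix ι (Fin 1) ℝ)
    (C : Matrix (Fin 1) ι ℝ) (D : ℝ) : ℝ[X] :=
  (C.map Polynomial.C * A.charmatrix.adjugate * B.map Polynomial.C :
    Matrix (Fin 1) (Fin 1) ℝ[X]) 0 0 + Polynomial.C D * A.charpoly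

/-- A general φ lets one adjugate computation serve both rational functions and evaluation at a
complex point. -/
theorem transferNumerator_div_charpoly {K : Type*} [Field K] (φ : ℝ[X] →+* K)
    (A : Matrix ι ι ℝ) (B : Matrix ι (Fin 1) ℝ) (C : Matrix (Fin 1) ι ℝ) (D : ℝ)
    (h : φ A.charpoly ≠ 0) :
    (C.map (φ.comp Polynomial.C) * (Matrix.scalar ι (φ X) - A.map (φ.comp Polynomial.C))⁻¹
      * B.map (φ.comp Polynomial.C) : Matrix (Fin 1) (Fin 1) K) 0 0 + φ (Polynomial.C D)
      = φ (transferNumerator A B C D) / φ A.charpoly := by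
  have hM : Matrix.scalar ι (φ X) - A.map (φ.comp Polynomial.C)
      = φ.mapMatrix A.charmatrix := by
    ext i j
    by_cases hij : i = j
    · subst hij; simp
    · simp [hij]
  have hnum : φ (transferNumerator A B C D) =
      (C.map (φ.comp Polynomial.C) * (φ.mapMatrix A.charmatrix).adjugate
        * B.map (φ.comp Polynomial.C)) 0 0 + φ (Polynomial.C D) * φ A.charpoly := by
    rw [transferNumerator, map_add, map_mul, ← RingHom.map_adjugate]
    congr 1
    simp [Matrix.mul_apply]
  rw [hM, Matrix.inv_def, ← RingHom.map_det, hnum, Ring.inverse_eq_inv', Matrix.mul_smul,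
    Matrix.smul_mul, Matrix.smul_apply, smul_eq_mul]
  change (φ A.charpoly)⁻¹ * _ + _ = _
  field_simp

theorem transferFunction_eq_div (A : Matrix ι ι ℝ) (B : Matrix ι (Fin 1) ℝ)
    (C : Matrix (Fin 1) ι ℝ) (D : ℝ) :
    transferFunction A B C D = algebraMap ℝ[X] (RatFunc ℝ) (transferNumerator A B C D)
      / algebraMap ℝ[X] (RatFunc ℝ) A.charpoly := by
  have h0 : algebraMap ℝ[X] (RatFunc ℝ) A.charpoly ≠ 0 := by
    rw [Ne, FaithfulSMul.algebraMap_eq_zero_iff]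
    exact A.charpoly_monic.ne_zero
  have hC : ((algebraMap ℝ[X] (RatFunc ℝ)).comp Polynomial.C) = RatFunc.C := by
    ext; simp
  have h := transferNumerator_div_charpoly (algebraMap ℝ[X] (RatFunc ℝ)) A B C D h0
  rw [hC, RatFunc.algebraMap_X, RatFunc.algebraMap_C] at h
  exact h

end TransferNumerator

theorem aeval_comp_C_mul_X (p : ℝ[X]) (a : ℝ) (z : ℂ) :
    aeval z (p.comp (C a * X)) = aeval ((a : ℂ) * z) p := by
  rw [aeval_comp]
  simp

/-- A delay model of order `N` with `N` states is all-pass with denominator a rescaled reverse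
Bessel polynomial. -/
theorem IsPadeOfDelay.charpoly_eq {τ : ℝ} (hτ : 0 < τ) {N : ℕ} {A : Matrix (Fin N) (Fin N) ℝ}
    {B : Matrix (Fin N) (Fin 1) ℝ} {C : Matrix (Fin 1) (Fin N) ℝ} {D : ℝ}
    (h : IsPadeOfDelay τ N (transferFunction A B C D)) :
    ∃ c : ℝ, c ≠ 0 ∧
      A.charpoly = Polynomial.C c * (reverseBessel N).comp (Polynomial.C (τ / 2) * X) ∧
      transferNumerator A B C D =
        Polynomial.C c * (reverseBessel N).comp (Polynomial.C (-(τ / 2)) * X) := by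
  obtain ⟨p, q, hp, hq, hq0, hP, hdvd⟩ := h
  have hdeg (a : ℝ) (ha : a ≠ 0) :
      ((reverseBessel N).comp (Polynomial.C a * X)).natDegree = N := by
    rw [natDegree_comp, reverseBessel_natDegree, natDegree_C_mul_X a ha, mul_one]
  have hτ2 : τ / 2 ≠ 0 := by positivity
  set q' := (reverseBessel N).comp (Polynomial.C (τ / 2) * X) with hq'
  set p' := (reverseBessel N).comp (Polynomial.C (-(τ / 2)) * X) with hp'
  have hq'N : q'.natDegree = N := hdeg _ hτ2
  have hp'N : p'.natDegree = N := hdeg _ (neg_ne_zero.2 hτ2)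
  have hcross : p * q' = p' * q :=
    pade_cross_mul_eq hp hq hp'N.le hq'N.le hdvd (pade_denominator_dvd τ N)
  have hqne : q ≠ 0 := by
    rintro rfl
    simp at hq0
  have hpol : transferNumerator A B C D * q = p * A.charpoly := by
    rw [transferFunction_eq_div, div_eq_div_iff] at hP
    · rw [← map_mul, ← map_mul] at hP
      exact FaithfulSMul.algebraMap_injective _ _ hP
    · rw [Ne, FaithfulSMul.algebraMap_eq_zero_iff]
      exact A.charpoly_monic.ne_zero
    · rwa [Ne, FaithfulSMul.algebraMap_eq_zero_iff]
  have hnum : transferNumerator A B C D * q' = p' * A.charpoly := by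
    apply mul_right_cancel₀ hqne
    linear_combination q' * hpol + A.charpoly * hcross
  -- The roots of q' lie in Re < 0 and those of its reflection p' in Re > 0.
  have hcop : IsCoprime q' p' := by
    rw [isCoprime_iff_aeval_ne_zero_of_isAlgClosed ℝ ℂ]
    intro z
    rw [hq', hp', aeval_comp_C_mul_X, aeval_comp_C_mul_X]
    rcases le_total 0 z.re with hz | hz
    · left
      apply aeval_reverseBessel_ne_zero
      rw [Complex.re_ofReal_mul]
      positivity
    · right
      apply aeval_reverseBessel_ne_zero
      rw [Complex.re_ofReal_mul]
      exact mul_nonneg_of_nonpos_of_nonpos (by linarith) hz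
  have hq'ne : q' ≠ 0 := by
    intro h0
    have := aeval_reverseBessel_ne_zero N (z := ((τ / 2 : ℝ) : ℂ) * 0) (by simp)
    rw [← aeval_comp_C_mul_X, ← hq', h0] at this
    simp at this
  obtain ⟨r, hr⟩ : q' ∣ A.charpoly :=
    hcop.dvd_of_dvd_mul_left ⟨transferNumerator A B C D, by rw [← hnum, mul_comm]⟩
  have hrne : r ≠ 0 := by
    rintro rfl
    exact A.charpoly_monic.ne_zero (by rw [hr, mul_zero])
  -- The model has exactly N states, so the degrees of q' and the characteristic polynomial agree.
  have hr0 : r.natDegree = 0 := by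
    have := congrArg natDegree hr
    rw [natDegree_mul hq'ne hrne, hq'N, Matrix.charpoly_natDegree_eq_dim, Fintype.card_fin] at this
    lia
  obtain ⟨c, rfl⟩ := natDegree_eq_zero.1 hr0
  refine ⟨c, by simpa using hrne, by rw [hr, mul_comm], ?_⟩
  apply mul_right_cancel₀ hq'ne
  rw [hnum, hr]
  ring

theorem IsPadeOfDelay.aeval_charpoly_ne_zero {τ : ℝ} (hτ : 0 < τ) {N : ℕ}
    {A : Matrix (Fin N) (Fin N) ℝ}
    {B : Matrix (Fin N) (Fin 1) ℝ} {C : Matrix (Fin 1) (Fin N) ℝ} {D : ℝ}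
    (h : IsPadeOfDelay τ N (transferFunction A B C D)) {z : ℂ} (hz : 0 ≤ z.re) :
    aeval z A.charpoly ≠ 0 := by
  obtain ⟨c, hc, h1, -⟩ := h.charpoly_eq hτ
  rw [h1, map_mul, aeval_C, aeval_comp_C_mul_X]
  refine mul_ne_zero (by simpa using hc) (aeval_reverseBessel_ne_zero N ?_)
  rw [Complex.re_ofReal_mul]
  positivity

theorem IsPadeOfDelay.aeval_transferNumerator {τ : ℝ} (hτ : 0 < τ) {N : ℕ}
    {A : Matrix (Fin N) (Fin N) ℝ}
    {B : Matrix (Fin N) (Fin 1) ℝ} {C : Matrix (Fin 1) (Fin N) ℝ} {D : ℝ}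
    (h : IsPadeOfDelay τ N (transferFunction A B C D)) (z : ℂ) :
    aeval z (transferNumerator A B C D) = aeval (-z) A.charpoly := by
  obtain ⟨c, hc, h1, h2⟩ := h.charpoly_eq hτ
  rw [h1, h2, map_mul, map_mul, aeval_C, aeval_C, aeval_comp_C_mul_X, aeval_comp_C_mul_X]
  simp

end DelayEstimator

/-! ### Spectral factorization from the Riccati equation. -/

namespace DelayEstimator

open Polynomial Matrix

theorem map_algebraMap_smul {ι κ : Type*} (a : ℝ) (R : Matrix ι κ ℝ) :
    (a • R).map (algebraMap ℝ ℂ) = (a : ℂ) • R.map (algebraMap ℝ ℂ) := by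
  ext
  simp

theorem vecMul_map_algebraMap {ι κ : Type*} [Fintype ι] (v : ι → ℂ) (R : Matrix ι κ ℝ) (j : κ) :
    (v ᵥ* R.map (algebraMap ℝ ℂ)) j
      = ⟨((fun i => (v i).re) ᵥ* R) j, ((fun i => (v i).im) ᵥ* R) j⟩ := by
  apply Complex.ext <;> simp [vecMul, dotProduct]

section Kalman

variable {ι : Type*} [Fintype ι] [DecidableEq ι]

/-- Applied with M = sI - A and M' = -sI - A. Multiplying the Riccati equation by C M⁻¹ on the left
and M'⁻ᵀ Cᵀ on the right gives x + y = V g g' - xy/W, which is (1 + x/W)(1 + y/W) = 1 + (V/W) g g'.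
The two factors on the left come from the matrix determinant lemma. -/
theorem det_mul_det_of_riccati {K : Type*} [Field K] {M M' S : Matrix ι ι K}
    {E : Matrix ι (Fin 1) K} {C : Matrix (Fin 1) ι K} {V W : K} (hW : W ≠ 0) (hS : Sᵀ = S)
    (hM : IsUnit M.det) (hM' : IsUnit M'.det)
    (h : M * S + S * M'ᵀ = V • (E * Eᵀ) - W⁻¹ • (S * Cᵀ * C * S)) :
    (M + (W⁻¹ • (S * Cᵀ)) * C).det * (M' + (W⁻¹ • (S * Cᵀ)) * C).det
      = M.det * M'.det * (1 + V / W * (C * M⁻¹ * E) 0 0 * (C * M'⁻¹ * E) 0 0) := by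
  have hdet {R : Matrix ι ι K} (hR : IsUnit R.det) : (R + (W⁻¹ • (S * Cᵀ)) * C).det
      = R.det * (1 + W⁻¹ * (C * R⁻¹ * S * Cᵀ) 0 0) := by
    rw [det_add_mul _ _ hR, det_fin_one]
    simp [Matrix.mul_assoc]
  have hT : IsUnit M'ᵀ.det := by rwa [det_transpose]
  have h1 : C * S * M'ᵀ⁻¹ * Cᵀ + C * M⁻¹ * S * Cᵀ
      = V • ((C * M⁻¹ * E) * (Eᵀ * M'ᵀ⁻¹ * Cᵀ))
        - W⁻¹ • ((C * M⁻¹ * S * Cᵀ) * (C * S * M'ᵀ⁻¹ * Cᵀ)) := by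
    have h2 := congrArg (fun R => C * (M⁻¹ * R * M'ᵀ⁻¹) * Cᵀ) h
    have h3 : M⁻¹ * (M * S + S * M'ᵀ) * M'ᵀ⁻¹ = S * M'ᵀ⁻¹ + M⁻¹ * S := by
      rw [Matrix.mul_add, Matrix.nonsing_inv_mul_cancel_left _ _ hM, Matrix.add_mul,
        Matrix.mul_assoc M⁻¹, Matrix.mul_nonsing_inv_cancel_right _ _ hT]
    rw [h3] at h2
    simpa only [Matrix.mul_add, Matrix.add_mul, Matrix.mul_sub, Matrix.sub_mul, Matrix.mul_smul,
      Matrix.smul_mul, Matrix.mul_assoc] using h2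
  have hY : C * S * M'ᵀ⁻¹ * Cᵀ = (C * M'⁻¹ * S * Cᵀ)ᵀ := by
    simp [transpose_mul, hS, transpose_nonsing_inv, Matrix.mul_assoc]
  have hG : Eᵀ * M'ᵀ⁻¹ * Cᵀ = (C * M'⁻¹ * E)ᵀ := by
    simp [transpose_mul, transpose_nonsing_inv, Matrix.mul_assoc]
  rw [hY, hG] at h1
  have h2 := congrFun (congrFun h1 0) 0
  simp only [Matrix.add_apply, Matrix.sub_apply, Matrix.smul_apply, transpose_apply, smul_eq_mul,
    Matrix.mul_apply (M := C * M⁻¹ * E), Matrix.mul_apply (M := C * M⁻¹ * S * Cᵀ),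
    Fin.sum_univ_one, Fin.isValue] at h2
  rw [hdet hM, hdet hM']
  set x := (C * M⁻¹ * S * Cᵀ) 0 0
  set y := (C * M'⁻¹ * S * Cᵀ) 0 0
  field_simp
  field_simp at h2
  linear_combination M.det * M'.det * h2

theorem aeval_charpoly (A : Matrix ι ι ℝ) (z : ℂ) :
    aeval z A.charpoly = (scalar ι z - A.map (algebraMap ℝ ℂ)).det := by
  rw [← eval_charpoly, charpoly_map, eval_map_algebraMap]

theorem mem_eigenvalues {A : Matrix ι ι ℝ} {z : ℂ} :
    z ∈ eigenvalues A ↔ aeval z A.charpoly = 0 := by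
  rw [eigenvalues, mem_roots (charpoly_monic _).ne_zero, IsRoot, charpoly_map,
    eval_map_algebraMap]

/-- The transfer function from `E` to `C`, as a function of a complex variable. -/
noncomputable def complexGain (A : Matrix ι ι ℝ) (E : Matrix ι (Fin 1) ℝ)
    (C : Matrix (Fin 1) ι ℝ) (z : ℂ) : ℂ :=
  (C.map (algebraMap ℝ ℂ) * (scalar ι z - A.map (algebraMap ℝ ℂ))⁻¹
    * E.map (algebraMap ℝ ℂ) : Matrix (Fin 1) (Fin 1) ℂ) 0 0

omit [DecidableEq ι] in
theorem IsPosDefRiccatiSolution.transpose_eq {A S : Matrix ι ι ℝ}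
    {E : Matrix ι (Fin 1) ℝ} {C : Matrix (Fin 1) ι ℝ} {V W : ℝ}
    (h : IsPosDefRiccatiSolution A E C V W S) : Sᵀ = S := by
  have := h.posDef.isHermitian
  rwa [Matrix.IsHermitian, conjTranspose_eq_transpose_of_trivial] at this

/-- The spectral factorization identity of the Kalman filter. -/
theorem IsPosDefRiccatiSolution.aeval_charpoly_mul {A S : Matrix ι ι ℝ}
    {E : Matrix ι (Fin 1) ℝ} {C : Matrix (Fin 1) ι ℝ} {V W : ℝ} (hW : W ≠ 0)
    (h : IsPosDefRiccatiSolution A E C V W S) {z : ℂ} (hz : aeval z A.charpoly ≠ 0)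
    (hz' : aeval (-z) A.charpoly ≠ 0) :
    aeval z (A - kalmanGain S C W * C).charpoly * aeval (-z) (A - kalmanGain S C W * C).charpoly
      = aeval z A.charpoly * aeval (-z) A.charpoly
        * (1 + (V / W : ℂ) * complexGain A E C z * complexGain A E C (-z)) := by
  simp only [aeval_charpoly] at *
  have hsub (w : ℂ) : scalar ι w - (A - kalmanGain S C W * C).map (algebraMap ℝ ℂ)
      = (scalar ι w - A.map (algebraMap ℝ ℂ))
        + ((W : ℂ)⁻¹ • (S.map (algebraMap ℝ ℂ) * (C.map (algebraMap ℝ ℂ))ᵀ))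
          * C.map (algebraMap ℝ ℂ) := by
    rw [Matrix.map_sub _ (map_sub _), Matrix.map_mul, kalmanGain, map_algebraMap_smul, Matrix.map_mul,
      transpose_map, Complex.ofReal_inv]
    abel
  rw [hsub, hsub]
  refine det_mul_det_of_riccati (by exact_mod_cast hW) ?_ hz.isUnit hz'.isUnit ?_
  · rw [← transpose_map, h.transpose_eq]
  · have h1 := congrArg (algebraMap ℝ ℂ).mapMatrix h.riccati
    simp only [map_zero, map_add, map_sub, map_mul, RingHom.mapMatrix_apply, map_algebraMap_smul] at h1
    simp only [Matrix.map_mul, transpose_map, Complex.ofReal_inv] at h1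
    simp only [transpose_sub, Matrix.sub_mul, Matrix.mul_sub, scalar_apply,
      ← smul_one_eq_diagonal, Matrix.smul_mul, Matrix.mul_smul, Matrix.one_mul, Matrix.mul_one,
      neg_smul, transpose_neg, transpose_smul, transpose_one, Matrix.mul_neg]
    rw [← sub_eq_zero, ← neg_eq_zero, h1]
    abel

end Kalman

/-! ### Location of the closed-loop eigenvalues. -/

section Lyapunov

variable {ι : Type*} [Fintype ι] [DecidableEq ι]

-- With F = A - LC the Riccati equation reads F S + S Fᵀ = -(V E Eᵀ + W L Lᵀ), because L C S = W L
-- Lᵀ is subtracted twice.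
omit [DecidableEq ι] in
theorem IsPosDefRiccatiSolution.lyapunov {A S : Matrix ι ι ℝ}
    {E : Matrix ι (Fin 1) ℝ} {C : Matrix (Fin 1) ι ℝ} {V W : ℝ} (hW : W ≠ 0)
    (h : IsPosDefRiccatiSolution A E C V W S) (x : ι → ℝ) :
    2 * ((x ᵥ* (A - kalmanGain S C W * C)) ⬝ᵥ S *ᵥ x)
      = -(V * ((x ᵥ* E) 0) ^ 2 + W * ((x ᵥ* kalmanGain S C W) 0) ^ 2) := by
  have hS := h.transpose_eq
  have hsymm (R : Matrix ι ι ℝ) : x ⬝ᵥ Rᵀ *ᵥ x = x ⬝ᵥ R *ᵥ x := by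
    rw [mulVec_transpose, dotProduct_comm, ← dotProduct_mulVec]
  have hsq (b c : Matrix ι (Fin 1) ℝ) : x ⬝ᵥ (b * cᵀ) *ᵥ x = (x ᵥ* b) 0 * (x ᵥ* c) 0 := by
    rw [← mulVec_mulVec, dotProduct_mulVec, mulVec_transpose]
    simp [dotProduct]
  have h1 : x ⬝ᵥ (0 : Matrix ι ι ℝ) *ᵥ x = x ⬝ᵥ (A * S + S * Aᵀ + V • (E * Eᵀ)
    - W⁻¹ • (S * Cᵀ * C * S)) *ᵥ x := by rw [← h.riccati]
  have h2 : S * Aᵀ = (A * S)ᵀ := by rw [transpose_mul, hS]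
  have h3 : S * Cᵀ * C * S = (S * Cᵀ) * (S * Cᵀ)ᵀ := by
    rw [transpose_mul, transpose_transpose, hS, ← Matrix.mul_assoc]
  have h4 : (kalmanGain S C W * C) * S = W⁻¹ • ((S * Cᵀ) * (S * Cᵀ)ᵀ) := by
    rw [← h3, kalmanGain, Matrix.smul_mul, Matrix.smul_mul]
  rw [← dotProduct_mulVec, mulVec_mulVec, Matrix.sub_mul, h4]
  rw [h2, h3] at h1
  simp only [sub_mulVec, add_mulVec, smul_mulVec, dotProduct_add, dotProduct_sub,
    dotProduct_smul, hsymm, hsq, zero_mulVec, dotProduct_zero, kalmanGain, vecMul_smul,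
    Pi.smul_apply, smul_eq_mul] at h1 ⊢
  field_simp at h1 ⊢
  linear_combination -h1

/-- For a left eigenvector v, split into real and imaginary parts, the Lyapunov identity gives 2
Re(z) v S v* = -(V|vE|² + W|vL|²). If Re z = 0 then vL = 0, and v is a left eigenvector of A itself.
-/
theorem IsPosDefRiccatiSolution.re_eigenvalue {A S : Matrix ι ι ℝ}
    {E : Matrix ι (Fin 1) ℝ} {C : Matrix (Fin 1) ι ℝ} {V W : ℝ} (hV : 0 ≤ V) (hW : 0 < W)
    (h : IsPosDefRiccatiSolution A E C V W S) {z : ℂ}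
    (hz : z ∈ eigenvalues (A - kalmanGain S C W * C)) :
    z.re ≤ 0 ∧ (z.re = 0 → z ∈ eigenvalues A) := by
  rw [mem_eigenvalues, aeval_charpoly, ← exists_vecMul_eq_zero_iff] at hz
  obtain ⟨v, hv, hvz⟩ := hz
  set F := A - kalmanGain S C W * C with hF
  set x : ι → ℝ := fun i => (v i).re with hx
  set y : ι → ℝ := fun i => (v i).im with hy
  have hvF (j : ι) : (v ᵥ* F.map (algebraMap ℝ ℂ)) j = z * v j := by
    have := congrFun hvz j
    rw [vecMul_sub, Pi.sub_apply, scalar_apply, vecMul_diagonal, Pi.zero_apply, sub_eq_zero] at this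
    rw [← this, mul_comm]
  have hxF : x ᵥ* F = z.re • x - z.im • y := by
    ext j
    have := congrArg Complex.re (hvF j)
    rw [vecMul_map_algebraMap, ← hx, ← hy] at this
    simpa using this
  have hyF : y ᵥ* F = z.re • y + z.im • x := by
    ext j
    have := congrArg Complex.im (hvF j)
    rw [vecMul_map_algebraMap, ← hx, ← hy] at this
    simpa using this
  have hlx := h.lyapunov hW.ne' x
  have hly := h.lyapunov hW.ne' y
  rw [← hF, hxF] at hlx
  rw [← hF, hyF] at hly
  have hxy : y ⬝ᵥ S *ᵥ x = x ⬝ᵥ S *ᵥ y := by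
    rw [dotProduct_mulVec, ← mulVec_transpose, h.transpose_eq, dotProduct_comm]
  simp only [sub_dotProduct, add_dotProduct, smul_dotProduct, smul_eq_mul, hxy] at hlx hly
  have hpos : 0 < x ⬝ᵥ S *ᵥ x + y ⬝ᵥ S *ᵥ y := by
    have hnn (w : ι → ℝ) : 0 ≤ w ⬝ᵥ S *ᵥ w := by
      simpa using h.posDef.posSemidef.dotProduct_mulVec_nonneg w
    have hp (w : ι → ℝ) (hw : w ≠ 0) : 0 < w ⬝ᵥ S *ᵥ w := by
      simpa using h.posDef.dotProduct_mulVec_pos hw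
    by_cases hx0 : x = 0
    · refine add_pos_of_nonneg_of_pos (hnn x) (hp y fun hy0 => hv ?_)
      ext j
      exact Complex.ext (congrFun hx0 j) (congrFun hy0 j)
    · exact add_pos_of_pos_of_nonneg (hp x hx0) (hnn y)
  have hsum : 2 * z.re * (x ⬝ᵥ S *ᵥ x + y ⬝ᵥ S *ᵥ y)
      = -(V * ((x ᵥ* E) 0 ^ 2 + (y ᵥ* E) 0 ^ 2)
        + W * ((x ᵥ* kalmanGain S C W) 0 ^ 2 + (y ᵥ* kalmanGain S C W) 0 ^ 2)) := by
    linear_combination hlx + hly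
  have hV' : 0 ≤ V * ((x ᵥ* E) 0 ^ 2 + (y ᵥ* E) 0 ^ 2) := by positivity
  have hW' : 0 ≤ W * ((x ᵥ* kalmanGain S C W) 0 ^ 2 + (y ᵥ* kalmanGain S C W) 0 ^ 2) := by
    positivity
  refine ⟨?_, fun hre => ?_⟩
  · by_contra! hre
    have := mul_pos hre hpos
    linarith
  · rw [hre] at hsum
    have h0 : (x ᵥ* kalmanGain S C W) 0 ^ 2 + (y ᵥ* kalmanGain S C W) 0 ^ 2 = 0 :=
      (mul_eq_zero.1 (le_antisymm (by linarith) hW')).resolve_left hW.ne'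
    have hx0 : (x ᵥ* kalmanGain S C W) 0 = 0 := by
      have := sq_nonneg ((y ᵥ* kalmanGain S C W) 0)
      exact pow_eq_zero_iff two_ne_zero |>.1 (le_antisymm (by linarith) (sq_nonneg _))
    have hy0 : (y ᵥ* kalmanGain S C W) 0 = 0 := by
      rw [hx0] at h0
      simpa using h0
    have hvL : v ᵥ* (kalmanGain S C W).map (algebraMap ℝ ℂ) = 0 := by
      ext j
      rw [vecMul_map_algebraMap, ← hx, ← hy, Subsingleton.elim j 0, hx0, hy0]
      rfl
    rw [mem_eigenvalues, aeval_charpoly, ← exists_vecMul_eq_zero_iff]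
    refine ⟨v, hv, ?_⟩
    rw [hF, Matrix.map_sub _ (map_sub _), Matrix.map_mul, vecMul_sub, vecMul_sub,
      ← vecMul_vecMul, hvL, zero_vecMul, sub_zero] at hvz
    rw [vecMul_sub, hvz]

end Lyapunov

end DelayEstimator

/-! ### Gain of the cascade and uniqueness of the spectral factor. -/

namespace DelayEstimator

open Polynomial Matrix

theorem nonsing_inv_mul_eq_of_mul_eq {K ι κ : Type*} [Field K] [Fintype ι] [DecidableEq ι]
    {M : Matrix ι ι K} {R T : Matrix ι κ K} (hM : IsUnit M.det) (h : M * R = T) :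
    M⁻¹ * T = R := by
  rw [← h, nonsing_inv_mul_cancel_left _ _ hM]

theorem complexGain_aug {n N : ℕ} (A : Matrix (Fin n) (Fin n) ℝ) (E : Matrix (Fin n) (Fin 1) ℝ)
    (C : Matrix (Fin 1) (Fin n) ℝ) (AN : Matrix (Fin N) (Fin N) ℝ) (BN : Matrix (Fin N) (Fin 1) ℝ)
    (CN : Matrix (Fin 1) (Fin N) ℝ) (DN : ℝ) {z : ℂ} (hA : aeval z A.charpoly ≠ 0)
    (hAN : aeval z AN.charpoly ≠ 0) :
    complexGain (augA A C AN BN) (augE N E) (augC C CN DN) z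
      = aeval z (transferNumerator AN BN CN DN) / aeval z AN.charpoly * complexGain A E C z := by
  have hφ : ((aeval z : ℝ[X] →ₐ[ℝ] ℂ) : ℝ[X] →+* ℂ).comp Polynomial.C = algebraMap ℝ ℂ := by
    ext
    simp
  have hP := transferNumerator_div_charpoly ((aeval z : ℝ[X] →ₐ[ℝ] ℂ) : ℝ[X] →+* ℂ) AN BN CN DN hAN
  rw [hφ] at hP
  simp only [RingHom.coe_coe, aeval_X, aeval_C] at hP
  rw [← hP]
  rw [aeval_charpoly] at hA hAN
  simp only [complexGain]
  set M := scalar (Fin n) z - A.map (algebraMap ℝ ℂ) with hM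
  set MN := scalar (Fin N) z - AN.map (algebraMap ℝ ℂ) with hMN
  set e := E.map (algebraMap ℝ ℂ) with he
  set c := C.map (algebraMap ℝ ℂ) with hc
  set b := BN.map (algebraMap ℝ ℂ) with hb
  set cN := CN.map (algebraMap ℝ ℂ) with hcN
  have h1 : scalar (Fin n ⊕ Fin N) z - (augA A C AN BN).map (algebraMap ℝ ℂ)
      = fromBlocks M 0 (-(b * c)) MN := by
    rw [hb, hc, ← Matrix.map_mul, augA, fromBlocks_map]
    ext (i | i) (j | j) <;> simp [hM, hMN, diagonal_apply]
  have h2 : (augE N E).map (algebraMap ℝ ℂ) = fromRows e 0 := by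
    ext (i | i) j <;> simp [augE, he]
  have h3 : (augC C CN DN).map (algebraMap ℝ ℂ) = fromCols ((DN : ℂ) • c) cN := by
    ext i (j | j) <;> simp [augC, hc, hcN]
  have hu : IsUnit (fromBlocks M 0 (-(b * c)) MN).det := by
    rw [det_fromBlocks_zero₁₂]
    exact (mul_ne_zero hA hAN).isUnit
  -- The resolvent applied to the input, by forward substitution: the plant state M⁻¹e drives the
  -- delay model.
  have h4 : fromBlocks M 0 (-(b * c)) MN * fromRows (M⁻¹ * e) (MN⁻¹ * (b * c) * (M⁻¹ * e))
      = fromRows e 0 := by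
    rw [fromBlocks_mul_fromRows, Matrix.zero_mul, add_zero,
      mul_nonsing_inv_cancel_left _ _ hA.isUnit, Matrix.mul_assoc MN⁻¹,
      mul_nonsing_inv_cancel_left _ _ hAN.isUnit, Matrix.neg_mul, neg_add_cancel]
  have h5 := nonsing_inv_mul_eq_of_mul_eq hu h4
  rw [h1, h2, h3, Matrix.mul_assoc, h5, fromCols_mul_fromRows]
  have h6 : cN * (MN⁻¹ * (b * c) * (M⁻¹ * e)) = (cN * MN⁻¹ * b) * (c * M⁻¹ * e) := by
    simp only [Matrix.mul_assoc]
  rw [h6, Matrix.smul_mul, ← Matrix.mul_assoc c, Matrix.add_apply, Matrix.smul_apply,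
    Matrix.mul_apply (M := cN * MN⁻¹ * b), Fin.sum_univ_one, smul_eq_mul, Complex.coe_algebraMap]
  ring

/-- A Hurwitz spectral factor is unique. -/
theorem eq_of_mul_comp_neg_X_eq {P Q : ℝ[X]} (hP : P.Monic) (hQ : Q.Monic)
    (hdeg : Q.natDegree ≤ P.natDegree) (hPre : ∀ z : ℂ, aeval z P = 0 → z.re ≤ 0)
    (hQre : ∀ z : ℂ, aeval z Q = 0 → z.re < 0) (h : P * P.comp (-X) = Q * Q.comp (-X)) :
    P = Q := by
  -- A common root would have Re ≤ 0 as a root of P and Re > 0 as a reflected root of Q, so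
  -- strictness is needed for Q only.
  have hcop : IsCoprime P (Q.comp (-X)) := by
    rw [isCoprime_iff_aeval_ne_zero_of_isAlgClosed ℝ ℂ]
    intro z
    by_contra! hz
    have h1 := hPre z hz.1
    have h2 := hQre (-z) (by simpa [aeval_comp] using hz.2)
    rw [Complex.neg_re] at h2
    linarith
  exact (eq_of_monic_of_dvd_of_natDegree_le hP hQ
    (hcop.dvd_of_dvd_mul_right ⟨_, h.symm⟩) hdeg).symm

theorem eq_of_forall_aeval_ne_zero {p q r : ℝ[X]} (hr : r ≠ 0)
    (h : ∀ z : ℂ, aeval z r ≠ 0 → aeval z p = aeval z q) : p = q := by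
  have h0 : r * (p - q) = 0 := by
    apply Polynomial.funext
    intro x
    have hx : aeval (algebraMap ℝ ℂ x) (r * (p - q)) = 0 := by
      by_cases hrx : aeval (algebraMap ℝ ℂ x) r = 0
      · rw [map_mul, hrx, zero_mul]
      · rw [map_mul, map_sub, h _ hrx, sub_self, mul_zero]
    rwa [aeval_algebraMap_eq_zero_iff, coe_aeval_eq_eval, ← eval_zero (x := x)] at hx
  exact sub_eq_zero.1 ((mul_eq_zero.1 h0).resolve_left hr)

end DelayEstimator

open Polynomial in
theorem mainTheorem1 (n N : ℕ) (τ : ℝ) (hτ : 0 < τ)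
    -- plant
    (A : Matrix (Fin n) (Fin n) ℝ) (E : Matrix (Fin n) (Fin 1) ℝ) (C : Matrix (Fin 1) (Fin n) ℝ)
    (hAC : Observable A C) (hAE : Controllable A E)
    -- delay model
    (AN : Matrix (Fin N) (Fin N) ℝ) (BN : Matrix (Fin N) (Fin 1) ℝ)
    (CN : Matrix (Fin 1) (Fin N) ℝ) (DN : ℝ)
    (hPade : IsMinimalPadeRealization τ AN BN CN DN)
    -- augmented system
    (hobs : Observable (augA A C AN BN) (augC C CN DN))
    (hctrl : Controllable (augA A C AN BN) (augE N E))
    -- noise covariances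
    (V W : ℝ) (hV : 0 ≤ V) (hW : 0 < W)
    -- error covariances of the augmented and of the delay-free problem
    (Saug : Matrix (Fin n ⊕ Fin N) (Fin n ⊕ Fin N) ℝ)
    (hSaug : IsPosDefRiccatiSolution (augA A C AN BN) (augE N E) (augC C CN DN) V W Saug)
    (S : Matrix (Fin n) (Fin n) ℝ) (hS : IsPosDefRiccatiSolution A E C V W S)
    -- pairwise disjoint spectra
    (hdisj₁ : Disjoint (eigenvalues AN) (eigenvalues A))
    (hdisj₂ : Disjoint (eigenvalues AN) (eigenvalues (A - kalmanGain S C W * C)))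
    (hdisj₃ : Disjoint (eigenvalues A) (eigenvalues (A - kalmanGain S C W * C))) :
    eigenvalues (augA A C AN BN - kalmanGain Saug (augC C CN DN) W * augC C CN DN)
      = eigenvalues AN + eigenvalues (A - kalmanGain S C W * C) := by
  have haug : (augA A C AN BN).charpoly = A.charpoly * AN.charpoly :=
    Matrix.charpoly_fromBlocks_zero₁₂ _ _ _
  have hmon := AN.charpoly_monic.mul (A - kalmanGain S C W * C).charpoly_monic
  have key : (augA A C AN BN - kalmanGain Saug (augC C CN DN) W * augC C CN DN).charpoly
      = AN.charpoly * (A - kalmanGain S C W * C).charpoly := by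
    refine eq_of_mul_comp_neg_X_eq (Matrix.charpoly_monic _) hmon ?_ (fun z hz => ?_)
      (fun z hz => ?_) ?_
    · rw [AN.charpoly_monic.natDegree_mul (Matrix.charpoly_monic _)]
      simp [Matrix.charpoly_natDegree_eq_dim, add_comm]
    · exact (hSaug.re_eigenvalue hV hW (mem_eigenvalues.2 hz)).1
    · rw [map_mul, mul_eq_zero] at hz
      rcases hz with hz | hz
      · by_contra! hre
        exact hPade.isPade.aeval_charpoly_ne_zero hτ hre hz
      · obtain ⟨hle, h0⟩ := hS.re_eigenvalue hV hW (mem_eigenvalues.2 hz)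
        refine lt_of_le_of_ne hle fun hre => ?_
        -- An imaginary-axis eigenvalue of A - LC would also be an eigenvalue of A.
        exact Multiset.disjoint_left.1 hdisj₃ (h0 hre) (mem_eigenvalues.2 hz)
    -- The factorization identity needs z and -z to avoid the open-loop spectrum; excluding these
    -- finitely many points loses nothing.
    · refine eq_of_forall_aeval_ne_zero (r := (augA A C AN BN).charpoly
        * (augA A C AN BN).charpoly.comp (-X)) ?_ fun z hz => ?_
      · refine mul_ne_zero (Matrix.charpoly_monic _).ne_zero fun h0 => ?_
        have := congrArg (fun p : ℝ[X] => p.comp (-X)) h0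
        simp [comp_assoc, (Matrix.charpoly_monic _).ne_zero] at this
      · have hcomp (p : ℝ[X]) : aeval z (p.comp (-X)) = aeval (-z) p := by simp [aeval_comp]
        simp only [map_mul, hcomp] at hz ⊢
        have h1 := hSaug.aeval_charpoly_mul hW.ne' (left_ne_zero_of_mul hz)
          (right_ne_zero_of_mul hz)
        simp only [haug, map_mul, mul_ne_zero_iff] at hz
        obtain ⟨⟨hA, hAN⟩, hA', hAN'⟩ := hz
        have h2 := hS.aeval_charpoly_mul hW.ne' hA hA'
        rw [complexGain_aug A E C AN BN CN DN hA hAN, complexGain_aug A E C AN BN CN DN hA' hAN',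
          hPade.isPade.aeval_transferNumerator hτ, hPade.isPade.aeval_transferNumerator hτ,
          haug, neg_neg, map_mul, map_mul] at h1
        -- The Padé factors χ_N(-z)/χ_N(z) and χ_N(z)/χ_N(-z) cancel here.
        rw [h1, mul_mul_mul_comm (aeval z AN.charpoly), h2]
        field_simp
  simp only [eigenvalues, Matrix.charpoly_map]
  rw [key, Polynomial.map_mul, roots_mul]
  exact mul_ne_zero (AN.charpoly_monic.map _).ne_zero
    ((Matrix.charpoly_monic _).map _).ne_zero
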